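/- Let $\varphi\colon (A,\mathfrak m)\to(B,\mathfrak n)$ be a local homomorphism of commutative noetherian local rings, where $A$ is regular and $B$ is Cohen-Macaulay (that is, the maximal length of a $B$-regular sequence in $\mathfrak n$ equals the Krull dimension $\dim B$). Let $\operatorname{flatdim}_A(B)$ be the flat dimension of $B$ as an $A$-module via $\varphi$, i.e. the least length of a resolution of $B$ by flat $A$-modules. Then $\operatorname{flatdim}_A(B)$ is finite and $$\operatorname{flatdim}_A(B)=\dim(A)-\dim(B)+\dim(B/\mathfrak m B),$$ where $\dim$ denotes Krull dimension. -/

import Mathlib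

universe u v

/-- A flat resolution `⋯ → X 2 → X 1 → X 0 → M → 0` of an `A`-module `M`: an exact sequence in which
every `X i` is a flat `A`-module. The universe `max u v` already contains the free resolutions. -/
structure FlatResolution (A : Type u) [CommRing A] (M : Type v) [AddCommGroup M] [Module A M] where
  /-- the modules of the resolution -/
  X : ℕ → Type (max u v)
  [addCommGroup : ∀ i, AddCommGroup (X i)]
  [module : ∀ i, Module A (X i)]
  flat : ∀ i, Module.Flat A (X i)
  /-- the differential -/
  d : ∀ i, X (i + 1) →ₗ[A] X i
  /-- the augmentation -/
  aug : X 0 →ₗ[A] M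
  aug_surjective : Function.Surjective aug
  exact_aug : Function.Exact (d 0) aug
  exact_d : ∀ i, Function.Exact (d (i + 1)) (d i)

/-- The flat dimension of an `A`-module `M`: the least `n` for which `M` has a flat resolution that
vanishes in all degrees above `n`. It is `⊤` if there is no bounded flat resolution, and `⊥` exactly
for the zero module. -/
noncomputable def flatDimension (A : Type u) [CommRing A] (M : Type v) [AddCommGroup M]
    [Module A M] : WithBot ℕ∞ :=
  sInf {n | ∃ F : FlatResolution A M, ∀ i : ℕ, n < (i : WithBot ℕ∞) → Subsingleton (F.X i)}

/-- The depth of a local ring: the supremum of the lengths of the regular sequences in its maximal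
ideal. -/
noncomputable def localDepth (R : Type u) [CommRing R] [IsLocalRing R] : ℕ∞ :=
  ⨆ rs ∈ {rs : List R | (∀ r ∈ rs, r ∈ IsLocalRing.maximalIdeal R) ∧
    RingTheory.Sequence.IsRegular R rs}, (rs.length : ℕ∞)

/-- A Cohen-Macaulay local ring: a noetherian local ring whose depth is its Krull dimension. -/
class IsCohenMacaulayLocalRing (R : Type u) [CommRing R] : Prop extends
    IsLocalRing R, IsNoetherianRing R where
  depth_eq_dim : (localDepth R : WithBot ℕ∞) = ringKrullDim R

-- Let `a`, `b`, `c` be the dimensions of `A`, `B`, `B/𝔪B`, and let `g` be the length of a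
-- `B`-regular sequence from `𝔪` that cannot be prolonged within `𝔪`. The flat dimension is `a - g`,
-- and `g = b - c`.
--
-- Modulo the sequence, `𝔪` kills a nonzero element, so some associated prime `q` of the quotient
-- contains `𝔪B`. The depth of the quotient is at most `dim B/q ≤ c`, and each regular element
-- lowers depth by at most one; Cohen-Macaulayness then gives `b ≤ g + c`. Conversely, the quotient
-- has dimension `b - g` and maps onto `B/𝔪B`.
--
-- Lower bound: mapping cones turn a flat resolution of `B` of length `l` into one of the quotient
-- of length `l + g`. As `𝔪` is generated by a regular sequence of length `a`, the killed element
-- forces `a ≤ l + g` (`HasWeaklyRegularResolution.length_le`).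
--
-- Upper bound: the residue field `k` has projective dimension `a`, and each regular element gains a
-- degree, so `Ext^i(k, B⋆) = 0` for `i > a - g`, with `B⋆` the character module. Although `B` need
-- not be finite over `A`, Nakayama over `B` extends this from `k` to all finite modules
-- (`subsingleton_ext_characterModule_of_residueField`), whence syzygies of `B` become flat.
--
-- `exists_isRegular_map_algebraMap` proves the three estimates along one sequence.

universe w

/-! ### Regular local rings -/

section RegularLocal

open IsLocalRing RingTheory.Sequence

variable {R : Type u} [CommRing R]

/-- An element outside the square of the maximal ideal belongs to a minimal system of generators. -/
lemma IsLocalRing.exists_span_insert_eq_maximalIdeal [IsLocalRing R] [IsNoetherianRing R] {x : R}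
    (hx : x ∈ maximalIdeal R) (hx2 : x ∉ maximalIdeal R ^ 2) :
    ∃ s : Set R, s.Finite ∧ s.ncard + 1 = (maximalIdeal R).spanFinrank ∧
      Ideal.span (insert x s) = maximalIdeal R := by
  classical
  have hv : (maximalIdeal R).toCotangent ⟨x, hx⟩ ≠ 0 := by
    rwa [Ne, Ideal.toCotangent_eq_zero]
  set v : CotangentSpace R := (maximalIdeal R).toCotangent ⟨x, hx⟩ with hvdef
  have hli : LinearIndepOn (ResidueField R) id {v} := by
    simpa [linearIndepOn_singleton_iff] using hv
  let b := Module.Basis.extend hli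
  have hfin : (hli.extend (Set.subset_univ {v})).Finite := Module.Finite.finite_basis b
  have hcard : (hli.extend (Set.subset_univ {v})).ncard = (maximalIdeal R).spanFinrank := by
    rw [spanFinrank_maximalIdeal_eq_finrank_cotangentSpace, ← Nat.card_coe_set_eq]
    exact (Module.finrank_eq_nat_card_basis b).symm
  have hvmem : v ∈ hli.extend (Set.subset_univ {v}) := Module.Basis.subset_extend hli rfl
  have hspan : Submodule.span (ResidueField R) (hli.extend (Set.subset_univ {v})) = ⊤ := by
    have := b.span_eq
    rwa [Module.Basis.range_extend] at this
  -- The section `l` need not send `v` to `x`, so `v` is dropped from the basis and `x` inserted by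
  -- hand.
  obtain ⟨l, hl⟩ := (maximalIdeal R).toCotangent_surjective.hasRightInverse
  set T := hli.extend (Set.subset_univ {v}) \ {v}
  have hT : insert v T = hli.extend (Set.subset_univ {v}) := by simp [T, Set.insert_eq_of_mem hvmem]
  have hTfin : T.Finite := hfin.subset Set.sdiff_subset
  have hinj : Function.Injective fun w ↦ (l w : R) :=
    Subtype.val_injective.comp hl.injective
  refine ⟨(fun w ↦ (l w : R)) '' T, hTfin.image _, ?_, ?_⟩
  · rw [Set.ncard_image_of_injective _ hinj, ← hcard, ← hT,
      Set.ncard_insert_of_notMem (by simp [T]) hTfin]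
  · have key : Submodule.span R (insert (⟨x, hx⟩ : maximalIdeal R) (l '' T)) = ⊤ := by
      rw [← CotangentSpace.span_image_eq_top_iff, Set.image_insert_eq, ← hvdef, Set.image_image]
      simp only [hl _, Set.image_id']
      rw [hT, hspan]
    have := congrArg (Submodule.map (maximalIdeal R).subtype) key
    rw [Submodule.map_span, Submodule.map_top, Submodule.range_subtype, Set.image_insert_eq,
      Set.image_image] at this
    exact this

/-- A regular local ring remains regular, with dimension one less, modulo an element outside the
square of the maximal ideal. -/
lemma IsRegularLocalRing.quotient_span_singleton [IsRegularLocalRing R] {x : R} {n : ℕ}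
    (hdim : ringKrullDim R = (n + 1 : ℕ)) (hx : x ∈ maximalIdeal R)
    (hx2 : x ∉ maximalIdeal R ^ 2) :
    IsRegularLocalRing (R ⧸ Ideal.span {x}) ∧ ringKrullDim (R ⧸ Ideal.span {x}) = n := by
  classical
  have hle : Ideal.span {x} ≤ maximalIdeal R := (Ideal.span_singleton_le_iff_mem _).mpr hx
  have : Nontrivial (R ⧸ Ideal.span {x}) :=
    Ideal.Quotient.nontrivial_iff.mpr fun h ↦ Ideal.IsPrime.ne_top' (top_le_iff.mp (h ▸ hle))
  have := IsLocalRing.of_surjective' _ (Ideal.Quotient.mk_surjective (I := Ideal.span {x}))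
  obtain ⟨s, hs, hcard, hspan⟩ := exists_span_insert_eq_maximalIdeal hx hx2
  have hm : maximalIdeal (R ⧸ Ideal.span {x}) =
      Ideal.span (Ideal.Quotient.mk (Ideal.span {x}) '' s) := by
    rw [← map_maximalIdeal_of_surjective _ (Ideal.Quotient.mk_surjective (I := Ideal.span {x})),
      ← hspan, Ideal.map_span, Set.image_insert_eq,
      Ideal.Quotient.eq_zero_iff_mem.mpr (Ideal.mem_span_singleton_self x)]
    exact Submodule.span_insert_zero
  have hrank : (maximalIdeal (R ⧸ Ideal.span {x})).spanFinrank ≤ n := by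
    have h1 := IsRegularLocalRing.spanFinrank_maximalIdeal (R := R)
    rw [hdim] at h1
    have h1 : (maximalIdeal R).spanFinrank = n + 1 := by exact_mod_cast h1
    rw [hm]
    refine (Submodule.spanFinrank_span_le_ncard_of_finite (hs.image _)).trans ?_
    have := Set.ncard_image_le (f := Ideal.Quotient.mk (Ideal.span {x})) hs
    omega
  -- One equation lowers the dimension by at most one; with `hrank` this squeezes dimension and
  -- embedding dimension together.
  have hdim2 : (n : WithBot ℕ∞) ≤ ringKrullDim (R ⧸ Ideal.span {x}) := by
    have h1 := ringKrullDim_le_ringKrullDim_quotient_add_spanFinrank (Ideal.span {x})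
      (by rwa [IsLocalRing.ringJacobson_eq_maximalIdeal])
    have h2 : (Ideal.span {x}).spanFinrank ≤ 1 := by
      simpa using Submodule.spanFinrank_span_le_ncard_of_finite (R := R) (Set.finite_singleton x)
    have h3 : ringKrullDim R ≤ ringKrullDim (R ⧸ Ideal.span {x}) + 1 :=
      h1.trans (by gcongr; exact_mod_cast h2)
    rw [hdim] at h3
    push_cast at h3
    exact (ENat.WithBot.add_le_add_natCast_right_iff (c := 1)).mp h3
  have hreg : IsRegularLocalRing (R ⧸ Ideal.span {x}) :=
    IsRegularLocalRing.of_spanFinrank_maximalIdeal_le _ (le_trans (by exact_mod_cast hrank) hdim2)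
  refine ⟨hreg, le_antisymm ?_ hdim2⟩
  rw [← hreg.spanFinrank_maximalIdeal]
  exact_mod_cast hrank

lemma IsRegularLocalRing.maximalIdeal_not_le_sq [IsRegularLocalRing R] {n : ℕ}
    (hdim : ringKrullDim R = (n + 1 : ℕ)) : ¬ maximalIdeal R ≤ maximalIdeal R ^ 2 := by
  intro h
  have h0 : maximalIdeal R = ⊥ :=
    Submodule.eq_bot_of_le_smul_of_le_jacobson_bot (maximalIdeal R) _
      (IsNoetherian.noetherian _) (by rwa [smul_eq_mul, ← sq]) (maximalIdeal_le_jacobson _)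
  have h1 := IsRegularLocalRing.spanFinrank_maximalIdeal (R := R)
  rw [h0, Submodule.spanFinrank_bot, hdim] at h1
  norm_cast at h1

/-- Induction on dimension: for suitable `x` the quotient by `x` is a domain, so `(x)` is prime. A
minimal prime `q ≤ (x)` avoiding `x` satisfies `q = xq`, hence is zero by Nakayama. -/
lemma IsRegularLocalRing.isDomain_of_ringKrullDim_eq (n : ℕ) :
    ∀ (R : Type u) [CommRing R] [IsRegularLocalRing R], ringKrullDim R = n → IsDomain R := by
  induction n with
  | zero =>
    intro R _ _ h
    have h1 := IsRegularLocalRing.spanFinrank_maximalIdeal (R := R)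
    rw [h] at h1
    have h1 : (maximalIdeal R).spanFinrank = 0 := by exact_mod_cast h1
    rw [Submodule.spanFinrank_eq_zero_iff_eq_bot (IsNoetherian.noetherian _),
      ← isField_iff_maximalIdeal_eq] at h1
    exact h1.isDomain
  | succ n ih =>
    intro R _ _ h
    have hm2 := IsRegularLocalRing.maximalIdeal_not_le_sq h
    obtain ⟨x, hx, hx'⟩ : ∃ x ∈ maximalIdeal R,
        x ∉ ⋃ I ∈ insert (maximalIdeal R ^ 2) (minimalPrimes R), (I : Set R) := by
      by_contra! hc
      have hfin : (insert (maximalIdeal R ^ 2) (minimalPrimes R)).Finite :=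
        (Ideal.finite_minimalPrimes_of_isNoetherianRing R ⊥).insert _
      -- Prime avoidance tolerates two non-prime ideals; `𝔪²` fills both slots.
      obtain ⟨I, hI, hle⟩ := (Ideal.subset_union_prime_finite hfin (f := id) (maximalIdeal R ^ 2)
        (maximalIdeal R ^ 2) (fun I hI h1 _ ↦ by
          exact Ideal.IsMinimalPrime.isPrime (hI.resolve_left h1))).mp hc
      rcases hI with rfl | hI
      · exact hm2 hle
      · have hp := Ideal.IsMinimalPrime.isPrime hI
        have heq : maximalIdeal R = I := le_antisymm hle (le_maximalIdeal hp.ne_top)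
        have h0 : (maximalIdeal R).height = 0 := by
          rw [Ideal.height_eq_zero_iff, heq]; exact hI
        have := maximalIdeal_height_eq_ringKrullDim (R := R)
        rw [h0, h] at this
        norm_cast at this
    simp only [Set.mem_iUnion, not_exists] at hx'
    have hx2 : x ∉ maximalIdeal R ^ 2 := fun h ↦ hx' _ (Set.mem_insert _ _) h
    obtain ⟨hreg, hd⟩ := IsRegularLocalRing.quotient_span_singleton h hx hx2
    have := ih _ hd
    have hprime : (Ideal.span {x}).IsPrime := (Ideal.Quotient.isDomain_iff_prime _).mp this
    obtain ⟨q, hq, hqle⟩ := Ideal.exists_minimalPrimes_le (bot_le : ⊥ ≤ Ideal.span {x})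
    have hqp := Ideal.IsMinimalPrime.isPrime hq
    have hxq : x ∉ q := fun h ↦ hx' q (Set.mem_insert_of_mem _ hq) h
    have hqbot : q = ⊥ := by
      refine Submodule.eq_bot_of_le_smul_of_le_jacobson_bot (Ideal.span {x}) q
        (IsNoetherian.noetherian _) (fun y hy ↦ ?_)
        (((Ideal.span_singleton_le_iff_mem _).mpr hx).trans (maximalIdeal_le_jacobson _))
      obtain ⟨z, rfl⟩ := Ideal.mem_span_singleton.mp (hqle hy)
      exact Ideal.mul_mem_mul (Ideal.mem_span_singleton_self x)
        ((hqp.mem_or_mem hy).resolve_left hxq)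
    subst hqbot
    exact (IsDomain.of_bot_isPrime R)

/-- The maximal ideal of a regular local ring is generated by a regular sequence. -/
lemma IsRegularLocalRing.exists_isRegular_ofList_eq (n : ℕ) :
    ∀ (R : Type u) [CommRing R] [IsRegularLocalRing R], ringKrullDim R = n →
      ∃ rs : List R, rs.length = n ∧ IsRegular R rs ∧ Ideal.ofList rs = maximalIdeal R := by
  suffices H : ∀ (R : Type u) [CommRing R] [IsRegularLocalRing R], ringKrullDim R = n →
      ∃ rs : List R, rs.length = n ∧ IsWeaklyRegular R rs ∧ Ideal.ofList rs = maximalIdeal R by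
    intro R _ _ h
    obtain ⟨rs, h1, h2, h3⟩ := H R h
    refine ⟨rs, h1, (isRegular_iff _ _).mpr ⟨h2, ?_⟩, h3⟩
    rw [h3, smul_eq_mul, Ideal.mul_top]
    exact Ideal.IsPrime.ne_top'.symm
  induction n with
  | zero =>
    intro R _ _ h
    have h1 := IsRegularLocalRing.spanFinrank_maximalIdeal (R := R)
    rw [h] at h1
    have h1 : (maximalIdeal R).spanFinrank = 0 := by exact_mod_cast h1
    rw [Submodule.spanFinrank_eq_zero_iff_eq_bot (IsNoetherian.noetherian _)] at h1
    exact ⟨[], rfl, IsWeaklyRegular.nil _ _, by simp [h1]⟩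
  | succ n ih =>
    intro R _ _ h
    have := IsRegularLocalRing.isDomain_of_ringKrullDim_eq _ R h
    obtain ⟨x, hx, hx2⟩ := SetLike.not_le_iff_exists.mp
      (IsRegularLocalRing.maximalIdeal_not_le_sq h)
    obtain ⟨hreg, hd⟩ := IsRegularLocalRing.quotient_span_singleton h hx hx2
    obtain ⟨rs', hl, hwr, hof⟩ := ih _ hd
    obtain ⟨rs, rfl⟩ := List.map_surjective_iff.mpr
      (Ideal.Quotient.mk_surjective (I := Ideal.span {x})) rs'
    have hx0 : x ≠ 0 := fun h ↦ hx2 (h ▸ zero_mem _)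
    refine ⟨x :: rs, by simpa using hl, ?_, ?_⟩
    · refine (isWeaklyRegular_cons_iff R x rs).mpr
        ⟨fun a b hab ↦ mul_left_cancel₀ hx0 hab, ?_⟩
      have e : QuotSMulTop x R ≃ₗ[R] R ⧸ Ideal.span {x} :=
        Submodule.quotEquivOfEq _ _ (by
          rw [← Submodule.ideal_span_singleton_smul, smul_eq_mul, Ideal.mul_top])
      rw [e.isWeaklyRegular_congr,
        ← isWeaklyRegular_map_algebraMap_iff (R ⧸ Ideal.span {x})]
      exact hwr
    · rw [← Ideal.map_ofList, ← map_maximalIdeal_of_surjective _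
        (Ideal.Quotient.mk_surjective (I := Ideal.span {x}))] at hof
      -- Pulling back to `R` adds the kernel `(x)` to the ideal of the lifted sequence.
      have h1 := congrArg (Ideal.comap (Ideal.Quotient.mk (Ideal.span {x}))) hof
      rw [Ideal.comap_map_mk ((Ideal.span_singleton_le_iff_mem _).mpr hx),
        Ideal.comap_map_of_surjective _ Ideal.Quotient.mk_surjective, ← RingHom.ker_eq_comap_bot,
        Ideal.mk_ker, sup_comm] at h1
      rw [Ideal.ofList_cons, h1]

end RegularLocal

/-! ### Lower bound for the length of resolutions -/

section WeaklyRegularResolution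

open RingTheory.Sequence
open scoped Pointwise

variable {A : Type u} [CommRing A]

/-- `M` has a resolution of length `n` by modules on which the sequence `rs` is weakly regular. -/
def HasWeaklyRegularResolution (rs : List A) : ℕ → ModuleCat.{w} A → Prop
  | 0, M => IsWeaklyRegular M rs
  | n + 1, M => ∃ (F K : ModuleCat.{w} A) (f : K →ₗ[A] F) (g : F →ₗ[A] M),
      Function.Injective f ∧ Function.Exact f g ∧ Function.Surjective g ∧ IsWeaklyRegular F rs ∧
        HasWeaklyRegularResolution rs n K

/-- This is the vanishing of `Tor₁(A/x, M)`: if `f k = x u`, then `x` kills `g u`, so `u` already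
comes from `K`. -/
lemma QuotSMulTop.map_injective_of_isSMulRegular {K F M : Type*} [AddCommGroup K] [Module A K]
    [AddCommGroup F] [Module A F] [AddCommGroup M] [Module A M] {f : K →ₗ[A] F} {g : F →ₗ[A] M}
    (hf : Function.Injective f) (hfg : Function.Exact f g) {x : A} (hx : IsSMulRegular M x) :
    Function.Injective (QuotSMulTop.map x f) := by
  rw [injective_iff_map_eq_zero]
  intro a ha
  obtain ⟨k, rfl⟩ := Submodule.mkQ_surjective _ a
  have h1 : f k ∈ x • (⊤ : Submodule A F) := (Submodule.Quotient.mk_eq_zero _).mp ha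
  obtain ⟨u, -, hu⟩ := (Submodule.mem_smul_pointwise_iff_exists _ _ _).mp h1
  have h2 : g u = 0 := hx (by
    change x • g u = x • 0
    rw [smul_zero, ← map_smul, hu, hfg.apply_apply_eq_zero])
  obtain ⟨k', rfl⟩ := (hfg u).mp h2
  have h3 : x • k' = k := hf (by rw [map_smul, hu])
  exact (Submodule.Quotient.mk_eq_zero _).mpr
    ((Submodule.mem_smul_pointwise_iff_exists _ _ _).mpr ⟨k', trivial, h3⟩)

lemma HasWeaklyRegularResolution.quotSMulTop {x : A} {rs : List A} (n : ℕ) :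
    ∀ (M : ModuleCat.{w} A), IsSMulRegular M x → HasWeaklyRegularResolution (x :: rs) n M →
      HasWeaklyRegularResolution rs n (ModuleCat.of A (QuotSMulTop x M)) := by
  induction n with
  | zero => exact fun M _ h ↦ ((isWeaklyRegular_cons_iff _ _ _).mp h).2
  | succ n ih =>
    rintro M hM ⟨F, K, f, g, hf, hfg, hg, hF, hK⟩
    obtain ⟨hFx, hF⟩ := (isWeaklyRegular_cons_iff _ _ _).mp hF
    have hKx : IsSMulRegular K x := hFx.of_injective f hf
    exact ⟨ModuleCat.of A (QuotSMulTop x F), ModuleCat.of A (QuotSMulTop x K),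
      QuotSMulTop.map x f, QuotSMulTop.map x g,
      QuotSMulTop.map_injective_of_isSMulRegular hf hfg hM, QuotSMulTop.map_exact x hfg hg,
      QuotSMulTop.map_surjective x hg, hF, ih K hKx hK⟩

/-- If a nonzero element of `M` is killed by the sequence `rs`, then every resolution of `M` by
modules on which `rs` is weakly regular has length at least the length of `rs`. -/
lemma HasWeaklyRegularResolution.length_le {n : ℕ} : ∀ {rs : List A} {M : ModuleCat.{w} A},
    HasWeaklyRegularResolution rs n M → ∀ {y : M}, y ≠ 0 → (∀ r ∈ rs, r • y = 0) →
      rs.length ≤ n := by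
  induction n with
  | zero =>
    rintro (_ | ⟨x, rs⟩) M h y hy hr
    · rfl
    · exact absurd (((isWeaklyRegular_cons_iff _ _ _).mp h).1
        (by simpa using hr x List.mem_cons_self : x • y = x • 0)) hy
  | succ n ih =>
    rintro (_ | ⟨x, rs⟩) M h y hy hr
    · simp
    obtain ⟨F, K, f, g, hf, hfg, hg, hF, hK⟩ := h
    have hFx := ((isWeaklyRegular_cons_iff _ _ _).mp hF).1
    obtain ⟨z, rfl⟩ := hg y
    -- Connecting map: lift `y` to `z` and view `x z` as an element `k` of `K`. Its class in `K/xK`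
    -- is nonzero and killed by the rest of the sequence, so one element is traded for one step of
    -- the resolution.
    have hex : ∀ r ∈ x :: rs, ∃ k : K, f k = r • z := fun r h ↦
      (hfg _).mp (by rw [map_smul, hr r h])
    obtain ⟨k, hk⟩ := hex x List.mem_cons_self
    have := ih (hK.quotSMulTop n K (hFx.of_injective f hf)) (y := Submodule.Quotient.mk k) ?_ ?_
    · simpa using this
    · intro h0
      obtain ⟨k', -, hk'⟩ := (Submodule.mem_smul_pointwise_iff_exists _ _ _).mp
        ((Submodule.Quotient.mk_eq_zero _).mp h0)
      have : f k' = z := hFx (by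
        change x • f k' = x • z
        rw [← map_smul, hk', hk])
      exact hy (by rw [← this, hfg.apply_apply_eq_zero])
    · intro r hr'
      obtain ⟨k', hk'⟩ := hex r (List.mem_cons_of_mem _ hr')
      have : r • k = x • k' := hf (by rw [map_smul, map_smul, hk, hk', smul_comm])
      rw [← Submodule.Quotient.mk_smul, this]
      exact (Submodule.Quotient.mk_eq_zero _).mpr
        (Submodule.smul_mem_pointwise_smul _ _ _ trivial)

end WeaklyRegularResolution

/-! ### Flat resolutions and mapping cones -/

lemma Module.Flat.prod (R M N : Type*) [CommRing R] [AddCommGroup M] [Module R M]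
    [AddCommGroup N] [Module R N] [Module.Flat R M] [Module.Flat R N] :
    Module.Flat R (M × N) := by
  rw [Module.Flat.iff_rTensor_injective']
  intro I
  rw [injective_iff_map_eq_zero]
  intro z hz
  have h1 : (LinearMap.fst R M N).lTensor I z = 0 := by
    refine (injective_iff_map_eq_zero _).mp (Module.Flat.iff_rTensor_injective'.mp ‹_› I) _ ?_
    rw [← LinearMap.comp_apply, LinearMap.rTensor_comp_lTensor, ← LinearMap.lTensor_comp_rTensor,
      LinearMap.comp_apply, hz, map_zero]
  have h2 : (LinearMap.snd R M N).lTensor I z = 0 := by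
    refine (injective_iff_map_eq_zero _).mp (Module.Flat.iff_rTensor_injective'.mp ‹_› I) _ ?_
    rw [← LinearMap.comp_apply, LinearMap.rTensor_comp_lTensor, ← LinearMap.lTensor_comp_rTensor,
      LinearMap.comp_apply, hz, map_zero]
  have h3 : (LinearMap.id : M × N →ₗ[R] M × N).lTensor I z = 0 := by
    have : (LinearMap.id : M × N →ₗ[R] M × N) = LinearMap.inl R M N ∘ₗ LinearMap.fst R M N +
        LinearMap.inr R M N ∘ₗ LinearMap.snd R M N := by ext <;> simp
    rw [this, LinearMap.lTensor_add]
    simp [LinearMap.lTensor_comp, h1, h2]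
  simpa using h3

namespace FlatResolution

open RingTheory.Sequence

attribute [instance] FlatResolution.addCommGroup FlatResolution.module

variable {A : Type u} [CommRing A] {M : Type v} [AddCommGroup M] [Module A M]

/-- The flat resolution of the kernel of the augmentation. -/
def shift (F : FlatResolution A M) :
    FlatResolution A (LinearMap.ker F.aug) where
  X i := F.X (i + 1)
  flat i := F.flat (i + 1)
  d i := F.d (i + 1)
  aug := (F.d 0).codRestrict _ fun x ↦ F.exact_aug.apply_apply_eq_zero x
  aug_surjective := fun ⟨y, hy⟩ ↦ by
    obtain ⟨x, rfl⟩ := (F.exact_aug y).mp hy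
    exact ⟨x, rfl⟩
  exact_aug x := by
    rw [← F.exact_d 0 x]
    exact Subtype.ext_iff
  exact_d i := F.exact_d (i + 1)

/-- A flat resolution of a module gives one of its lift to a larger universe. -/
def toULift (F : FlatResolution A M) : FlatResolution.{u, max u v} A (ULift.{u} M) where
  X := F.X
  flat := F.flat
  d := F.d
  aug := ULift.moduleEquiv.symm.toLinearMap.comp F.aug
  aug_surjective := (ULift.moduleEquiv (R := A) (M := M)).symm.surjective.comp F.aug_surjective
  exact_aug := by
    intro x
    rw [← F.exact_aug x]
    exact LinearEquiv.map_eq_zero_iff ULift.moduleEquiv.symm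
  exact_d := F.exact_d

/-- A flat resolution of the lift of a module to a larger universe gives one of the module. -/
def ofULift (F : FlatResolution.{u, max u v} A (ULift.{u} M)) : FlatResolution A M where
  X := F.X
  flat := F.flat
  d := F.d
  aug := ULift.moduleEquiv.toLinearMap.comp F.aug
  aug_surjective := (ULift.moduleEquiv (R := A) (M := M)).surjective.comp F.aug_surjective
  exact_aug := by
    intro x
    rw [← F.exact_aug x]
    exact (ULift.moduleEquiv (R := A) (M := M)).map_eq_zero_iff
  exact_d := F.exact_d

/-- Tensoring with a flat module preserves weak regularity, so every term of a flat resolution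
inherits it from `A`. -/
lemma hasWeaklyRegularResolution {rs : List A} (hrs : IsWeaklyRegular A rs) (n : ℕ) :
    ∀ (M : Type max u v) [AddCommGroup M] [Module A M] (F : FlatResolution.{u, max u v} A M),
      (∀ i, n < i → Subsingleton (F.X i)) →
      HasWeaklyRegularResolution rs n (ModuleCat.of A M) := by
  have hflat : ∀ (X : Type max u v) [AddCommGroup X] [Module A X], Module.Flat A X →
      IsWeaklyRegular X rs := fun X _ _ _ ↦
    ((TensorProduct.rid A X).isWeaklyRegular_congr rs).mp (hrs.isWeaklyRegular_lTensor)
  induction n with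
  | zero =>
    intro M _ _ F h
    have := h 1 one_pos
    have hinj : Function.Injective F.aug := by
      rw [injective_iff_map_eq_zero]
      intro x hx
      obtain ⟨z, rfl⟩ := (F.exact_aug x).mp hx
      rw [Subsingleton.elim z 0, map_zero]
    exact ((LinearEquiv.ofBijective F.aug ⟨hinj, F.aug_surjective⟩ : F.X 0 ≃ₗ[A] M).isWeaklyRegular_congr rs).mp
      (hflat _ (F.flat 0))
  | succ n ih =>
    intro M _ _ F h
    exact ⟨ModuleCat.of A (F.X 0), ModuleCat.of A (LinearMap.ker F.aug),
      (LinearMap.ker F.aug).subtype, F.aug, Subtype.val_injective,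
      F.aug.exact_subtype_ker_map, F.aug_surjective, hflat _ (F.flat 0),
      ih _ F.shift fun i hi ↦ h (i + 1) (by omega)⟩

section Cone

variable {M : Type max u v} [AddCommGroup M] [Module A M] (F : FlatResolution.{u, max u v} A M)

/-- The modules of the mapping cone of a homothety on a flat resolution. -/
def coneX : ℕ → Type max u v
  | 0 => F.X 0
  | i + 1 => F.X (i + 1) × F.X i

instance : ∀ i, AddCommGroup (F.coneX i)
  | 0 => F.addCommGroup 0
  | i + 1 => inferInstanceAs (AddCommGroup (F.X (i + 1) × F.X i))

instance : ∀ i, Module A (F.coneX i)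
  | 0 => F.module 0
  | i + 1 => inferInstanceAs (Module A (F.X (i + 1) × F.X i))

/-- The differential of the mapping cone of a homothety on a flat resolution. -/
def coneD (x : A) : ∀ i, F.coneX (i + 1) →ₗ[A] F.coneX i
  | 0 => LinearMap.coprod (F.d 0) (LinearMap.lsmul A (F.X 0) x)
  | i + 1 => LinearMap.prod (LinearMap.coprod (F.d (i + 1)) (LinearMap.lsmul A (F.X (i + 1)) x))
      -- The sign cancels the cross terms `x d b` in the square of the differential.
      (-(F.d i ∘ₗ LinearMap.snd A (F.X (i + 2)) (F.X (i + 1))))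

variable {M' : Type max u v} [AddCommGroup M'] [Module A M'] {x : A} (hx : IsSMulRegular M x)
  {π : M →ₗ[A] M'} (hπ : Function.Surjective π) (hex : Function.Exact (LinearMap.lsmul A M x) π)

/-- The mapping cone of multiplication by an `M`-regular element `x` on a flat resolution of `M`
is a flat resolution of the cokernel of multiplication by `x` on `M`. -/
def cone : FlatResolution.{u, max u v} A M' where
  X := F.coneX
  flat
    | 0 => F.flat 0
    | i + 1 => by
      have := F.flat i
      have := F.flat (i + 1)
      exact Module.Flat.prod A (F.X (i + 1)) (F.X i)
  d := F.coneD x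
  aug := π ∘ₗ F.aug
  aug_surjective := hπ.comp F.aug_surjective
  exact_aug := by
    intro (y : F.X 0)
    refine (hex (F.aug y)).trans ?_
    constructor
    · rintro ⟨m, hm : x • m = F.aug y⟩
      obtain ⟨z, rfl⟩ := F.aug_surjective m
      obtain ⟨a, ha⟩ := (F.exact_aug (y - x • z)).mp (by rw [map_sub, map_smul, hm, sub_self])
      exact ⟨(a, z), show F.d 0 a + x • z = y by rw [ha, sub_add_cancel]⟩
    · rintro ⟨(⟨a, z⟩ : F.X 1 × F.X 0), rfl⟩
      refine ⟨F.aug z, ?_⟩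
      change x • F.aug z = F.aug (F.d 0 a + x • z)
      rw [map_add, F.exact_aug.apply_apply_eq_zero, zero_add, map_smul]
  exact_d := by
    rintro (_ | i)
    · rintro (⟨a, b⟩ : F.X 1 × F.X 0)
      constructor
      · intro (h : F.d 0 a + x • b = 0)
        -- The only use of regularity of `x`: it kills the homology of the cone in degree one.
        have hb : F.aug b = 0 := hx (by
          change x • F.aug b = x • (0 : M)
          have := congrArg F.aug h
          rw [map_add, F.exact_aug.apply_apply_eq_zero, zero_add, map_smul, map_zero] at this
          rw [this, smul_zero])
        obtain ⟨c, rfl⟩ := (F.exact_aug b).mp hb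
        obtain ⟨e, he⟩ := (F.exact_d 0 (a + x • c)).mp (by rw [map_add, map_smul, h])
        refine ⟨(e, -c), Prod.ext ?_ ?_⟩
        · change F.d 1 e + x • (-c) = a
          rw [he, smul_neg, add_neg_cancel_right]
        · change -(F.d 0 (-c)) = _
          rw [map_neg, neg_neg]
      · rintro ⟨(⟨e, c⟩ : F.X 2 × F.X 1), h⟩
        obtain ⟨h1, h2⟩ := Prod.ext_iff.mp h
        change F.d 1 e + x • c = a at h1
        change -(F.d 0 c) = b at h2
        change F.d 0 a + x • b = 0
        rw [← h1, ← h2, map_add, (F.exact_d 0).apply_apply_eq_zero, zero_add, map_smul, smul_neg,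
          add_neg_cancel]
    · rintro (⟨a, b⟩ : F.X (i + 2) × F.X (i + 1))
      constructor
      · intro h
        obtain ⟨h1, h2⟩ := Prod.ext_iff.mp h
        change F.d (i + 1) a + x • b = 0 at h1
        change -(F.d i b) = 0 at h2
        obtain ⟨c, rfl⟩ := (F.exact_d i b).mp (neg_eq_zero.mp h2)
        obtain ⟨e, he⟩ := (F.exact_d (i + 1) (a + x • c)).mp (by rw [map_add, map_smul, h1])
        refine ⟨(e, -c), Prod.ext ?_ ?_⟩
        · change F.d (i + 2) e + x • (-c) = a
          rw [he, smul_neg, add_neg_cancel_right]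
        · change -(F.d (i + 1) (-c)) = _
          rw [map_neg, neg_neg]
      · rintro ⟨(⟨e, c⟩ : F.X (i + 3) × F.X (i + 2)), h⟩
        obtain ⟨h1, h2⟩ := Prod.ext_iff.mp h
        change F.d (i + 2) e + x • c = a at h1
        change -(F.d (i + 1) c) = b at h2
        refine Prod.ext ?_ ?_
        · change F.d (i + 1) a + x • b = 0
          rw [← h1, ← h2, map_add, (F.exact_d (i + 1)).apply_apply_eq_zero, zero_add, map_smul,
            smul_neg, add_neg_cancel]
        · change -(F.d i b) = 0
          rw [← h2, map_neg, (F.exact_d i).apply_apply_eq_zero, neg_zero, neg_zero]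

lemma subsingleton_cone_X {n : ℕ}
    (h : ∀ i, n < i → Subsingleton (F.X i)) : ∀ i, n + 1 < i → Subsingleton ((F.cone hx hπ hex).X i)
  | 0, hi => absurd hi (by omega)
  | i + 1, hi => by
    have := h i (by omega)
    have := h (i + 1) (by omega)
    exact inferInstanceAs (Subsingleton (F.X (i + 1) × F.X i))

end Cone

end FlatResolution

/-! ### Character modules and Nakayama -/

section CharacterModule

open TensorProduct

variable {A : Type u} [CommRing A]

/-- A character killed by `dual f` factors through the range of `g`, and characters extend from
submodules. -/
lemma CharacterModule.dual_exact {K F M : Type*} [AddCommGroup K] [Module A K]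
    [AddCommGroup F] [Module A F] [AddCommGroup M] [Module A M]
    {f : K →ₗ[A] F} {g : F →ₗ[A] M} (hfg : Function.Exact f g) :
    Function.Exact (CharacterModule.dual g) (CharacterModule.dual f) := by
  intro φ
  constructor
  · intro h
    have hker : g.rangeRestrict.toAddMonoidHom.ker ≤ AddMonoidHom.ker φ := by
      intro x hx
      have hx : g x = 0 := congrArg Subtype.val (show g.rangeRestrict x = 0 from hx)
      obtain ⟨y, rfl⟩ := (hfg x).mp hx
      exact DFunLike.congr_fun h y
    obtain ⟨ψ, hψ⟩ := CharacterModule.dual_surjective_of_injective (LinearMap.range g).subtype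
      Subtype.val_injective (AddMonoidHom.liftOfSurjective g.rangeRestrict.toAddMonoidHom
        g.surjective_rangeRestrict ⟨φ, hker⟩)
    refine ⟨ψ, ?_⟩
    ext x
    have h1 := DFunLike.congr_fun hψ (g.rangeRestrict x)
    exact h1.trans (AddMonoidHom.liftOfRightInverse_comp_apply _ _ _ ⟨φ, hker⟩ x)
  · rintro ⟨ψ, rfl⟩
    ext x
    change ψ (g (f x)) = 0
    rw [hfg.apply_apply_eq_zero, map_zero]

variable {B : Type v} [CommRing B] [Algebra A B]
  {M : Type*} [AddCommGroup M] [Module A M] [Module B M] [IsScalarTower A B M]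
  {N F : Type*} [AddCommGroup N] [Module A N] [AddCommGroup F] [Module A F]

/-- `M ⊗[A] N` is `M ⊗[B] (B ⊗[A] N)`; this finiteness over `B` is what permits Nakayama. -/
lemma Module.Finite.tensorProduct_of_isScalarTower [Module.Finite B M] [Module.Finite A N] :
    Module.Finite B (M ⊗[A] N) :=
  Module.Finite.equiv (TensorProduct.AlgebraTensorModule.cancelBaseChange A B B M N)

variable (A M) in
/-- Linear maps into a character module are the characters of the tensor product. -/
noncomputable def CharacterModule.homEquivComm (N : Type*) [AddCommGroup N] [Module A N] :
    (N →ₗ[A] CharacterModule M) ≃ₗ[A] CharacterModule (M ⊗[A] N) :=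
  CharacterModule.homEquiv ≪≫ₗ CharacterModule.congr (TensorProduct.comm A N M)

lemma CharacterModule.homEquivComm_comp (f : N →ₗ[A] F) (ψ : F →ₗ[A] CharacterModule M) :
    homEquivComm A M N (ψ ∘ₗ f) = dual (f.lTensor M) (homEquivComm A M F ψ) := by
  ext t
  induction t with
  | zero => rw [map_zero, map_zero]
  | add a b ha hb => rw [map_add, ha, hb, map_add]
  | tmul m n => rfl

/-- A form of Nakayama's lemma for the cokernel of `Hom(F, M⋆) → Hom(N, M⋆)`, where `M` is a finite
module over the noetherian local `A`-algebra `B`: this cokernel vanishes if an element of `A` that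
maps to the maximal ideal of `B` acts injectively on it. -/
lemma CharacterModule.exists_eq_comp_of_forall_smul [IsLocalRing B] [IsNoetherianRing B]
    [Module.Finite B M] [Module.Finite A N] (f : N →ₗ[A] F) {x : A}
    (hx : algebraMap A B x ∈ IsLocalRing.maximalIdeal B)
    (h : ∀ φ : N →ₗ[A] CharacterModule M, (∃ ψ : F →ₗ[A] CharacterModule M, x • φ = ψ ∘ₗ f) →
      ∃ ψ : F →ₗ[A] CharacterModule M, φ = ψ ∘ₗ f)
    (φ : N →ₗ[A] CharacterModule M) : ∃ ψ : F →ₗ[A] CharacterModule M, φ = ψ ∘ₗ f := by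
  have : Module.Finite B (M ⊗[A] N) := Module.Finite.tensorProduct_of_isScalarTower
  let j : M ⊗[A] N →ₗ[B] M ⊗[A] F := TensorProduct.AlgebraTensorModule.lTensor B M f
  have hjf : ∀ t, j t = f.lTensor M t := fun _ ↦ rfl
  -- The cokernel is dual to `ker j`. Injectivity of `x` on it says that a character `c` vanishes on
  -- `ker j` as soon as `x c` does.
  have key : ∀ c : CharacterModule (M ⊗[A] N), (∀ t, j t = 0 → c (x • t) = 0) →
      ∀ t, j t = 0 → c t = 0 := by
    intro c hc t ht
    obtain ⟨d, hd⟩ := (dual_exact (f.lTensor M).exact_subtype_ker_map (x • c)).mp (by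
      ext ⟨t, ht⟩
      exact hc t ht)
    obtain ⟨ψ, hψ⟩ := h ((homEquivComm A M N).symm c) ⟨(homEquivComm A M F).symm d, by
      apply (homEquivComm A M N).injective
      rw [homEquivComm_comp, map_smul, LinearEquiv.apply_symm_apply, LinearEquiv.apply_symm_apply,
        hd]⟩
    have h1 : c = dual (f.lTensor M) (homEquivComm A M F ψ) := by
      rw [← homEquivComm_comp, ← hψ, LinearEquiv.apply_symm_apply]
    rw [h1]
    change homEquivComm A M F ψ (j t) = 0
    rw [ht, map_zero]
  -- Characters separate points modulo `x ker j`, so `key` forces `ker j = x ker j`.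
  have hle : LinearMap.ker j ≤ Ideal.span {algebraMap A B x} • LinearMap.ker j := by
    intro t ht
    by_contra hnot
    obtain ⟨c, hc⟩ := CharacterModule.exists_character_apply_ne_zero_of_ne_zero
      (a := (Submodule.Quotient.mk t : _ ⧸ Ideal.span {algebraMap A B x} • LinearMap.ker j))
      (by rwa [Ne, Submodule.Quotient.mk_eq_zero])
    refine hc (key (c.comp (Ideal.span {algebraMap A B x} • LinearMap.ker j).mkQ.toAddMonoidHom)
      (fun s hs ↦ ?_) t ht)
    have : (Ideal.span {algebraMap A B x} • LinearMap.ker j).mkQ (x • s) = 0 := by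
      rw [Submodule.mkQ_apply, Submodule.Quotient.mk_eq_zero, ← algebraMap_smul B x s]
      exact Submodule.smul_mem_smul (Ideal.mem_span_singleton_self _) hs
    change c ((Ideal.span {algebraMap A B x} • LinearMap.ker j).mkQ (x • s)) = 0
    rw [this, map_zero]
  have hbot : LinearMap.ker j = ⊥ :=
    Submodule.eq_bot_of_le_smul_of_le_jacobson_bot _ _ (IsNoetherian.noetherian _) hle
      (((Ideal.span_singleton_le_iff_mem _).mpr hx).trans
        (IsLocalRing.maximalIdeal_le_jacobson _))
  obtain ⟨d, hd⟩ := CharacterModule.dual_surjective_of_injective (f.lTensor M)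
    (show Function.Injective j from LinearMap.ker_eq_bot.mp hbot) (homEquivComm A M N φ)
  refine ⟨(homEquivComm A M F).symm d, (homEquivComm A M N).injective ?_⟩
  rw [homEquivComm_comp, LinearEquiv.apply_symm_apply, hd]

end CharacterModule

/-! ### Ext into character modules -/

section Ext

open CategoryTheory Abelian

variable {A : Type u} [CommRing A] [Small.{w} A]

/-- Multiplication by an `M`-regular element acting as zero on `k` gives, through the character
modules, a shift in the vanishing of `Ext` groups. -/
lemma subsingleton_ext_characterModule_of_exact_lsmul (k : ModuleCat.{w} A) {M M' : Type w}
    [AddCommGroup M] [Module A M] [AddCommGroup M'] [Module A M'] {x : A}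
    (hxk : x ∈ Module.annihilator A k) (hx : IsSMulRegular M x)
    {π : M →ₗ[A] M'} (hπ : Function.Surjective π) (hex : Function.Exact (LinearMap.lsmul A M x) π)
    (i : ℕ) (h : Subsingleton (Ext k (ModuleCat.of A (CharacterModule M')) (i + 1))) :
    Subsingleton (Ext k (ModuleCat.of A (CharacterModule M)) i) := by
  let f := CharacterModule.dual (LinearMap.lsmul A M x)
  let g := CharacterModule.dual π
  have hex : Function.Exact g f := CharacterModule.dual_exact hex
  let S := ModuleCat.shortComplexOfCompEqZero g f hex.linearMap_comp_eq_zero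
  have hS : S.ShortExact := ModuleCat.shortComplex_shortExact S hex
    (CharacterModule.dual_injective_of_surjective _ hπ)
    (CharacterModule.dual_surjective_of_injective _ hx)
  have hSg : S.g = x • 𝟙 S.X₃ := by
    ext φ m
    exact rfl
  -- In `0 → M'⋆ → M⋆ → M⋆ → 0` the last map is multiplication by `x`. The vanishing of the next
  -- `Ext` makes `e` a multiple `x e'`, which is zero since `x` kills `k`.
  refine subsingleton_of_forall_eq 0 fun e ↦ ?_
  obtain ⟨e', rfl⟩ := Ext.covariant_sequence_exact₃ k hS e rfl (h.elim _ _)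
  have h0 : x • 𝟙 k = 0 := by
    rw [← ModuleCat.lsmul_eq_smul_id, Module.mem_annihilator_iff_lsmul_eq_zero.mp hxk]
    rfl
  have h1 : x • e' = 0 := by
    have : x • e' = (Ext.mk₀ (x • 𝟙 k)).comp e' (zero_add i) := by simp [Ext.mk₀_smul]
    rw [this, h0, Ext.mk₀_zero, Ext.zero_comp]
  rw [hSg]
  exact (Ext.smul_eq_comp_mk₀ e' x).symm.trans h1

variable {B : Type v} [CommRing B] [Algebra A B] [IsLocalRing B] [IsNoetherianRing B]
  [IsNoetherianRing A] {M : Type w} [AddCommGroup M] [Module A M] [Module B M]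
  [IsScalarTower A B M] [Module.Finite B M]

/-- Nakayama's lemma for `Ext` into the character module of a finite module over a noetherian
local algebra. -/
lemma subsingleton_ext_characterModule_of_forall_smul {x : A}
    (hx : algebraMap A B x ∈ IsLocalRing.maximalIdeal B) (n : ℕ) :
    ∀ (N : ModuleCat.{w} A) [Module.Finite A N],
      (∀ e : Ext N (ModuleCat.of A (CharacterModule M)) (n + 1), x • e = 0 → e = 0) →
      Subsingleton (Ext N (ModuleCat.of A (CharacterModule M)) (n + 1)) := by
  induction n with
  | zero =>
    intro N _ h
    obtain ⟨P, _, _, _, _, f, hf⟩ := Module.exists_finite_presentation A N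
    have hS := LinearMap.shortExact_shortComplexKer hf
    have hsurj := precomp_extClass_surjective_of_projective_X₂
      (ModuleCat.of A (CharacterModule M)) hS 0
    -- `Ext¹(N, M⋆)` is the cokernel of `Hom(P, M⋆) → Hom(ker f, M⋆)`.
    have key := CharacterModule.exists_eq_comp_of_forall_smul (M := M) (LinearMap.ker f).subtype hx
      (fun φ ⟨ψ, hψ⟩ ↦ by
        have h1 := h (hS.extClass.comp (Ext.mk₀ (ModuleCat.ofHom φ)) rfl) (by
          have : x • ModuleCat.ofHom φ = (LinearMap.shortComplexKer f).f ≫ ModuleCat.ofHom ψ := by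
            exact ModuleCat.hom_ext hψ
          rw [← Ext.comp_smul, ← Ext.mk₀_smul, this, ← Ext.mk₀_comp_mk₀]
          exact hS.extClass_comp_assoc _)
        obtain ⟨e, he⟩ := Ext.contravariant_sequence_exact₁ hS _ _ rfl h1
        obtain ⟨ψ', rfl⟩ := (Ext.mk₀_bijective _ _).2 e
        rw [Ext.mk₀_comp_mk₀] at he
        refine ⟨ψ'.hom, ?_⟩
        have := (Ext.mk₀_bijective _ _).1 he
        exact (congrArg ModuleCat.Hom.hom this).symm)
    refine subsingleton_of_forall_eq 0 fun e ↦ ?_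
    obtain ⟨e', rfl⟩ := hsurj e
    obtain ⟨φ, rfl⟩ := (Ext.mk₀_bijective _ _).2 e'
    obtain ⟨ψ, hψ⟩ := key φ.hom
    have : φ = (LinearMap.shortComplexKer f).f ≫ ModuleCat.ofHom ψ := by
      exact ModuleCat.hom_ext hψ
    have h2 : hS.extClass.comp (Ext.mk₀ φ) (add_comm 1 0) = 0 := by
      rw [this, ← Ext.mk₀_comp_mk₀]
      exact hS.extClass_comp_assoc _
    exact h2
  | succ n ih =>
    intro N _ h
    obtain ⟨P, _, _, _, _, f, hf⟩ := Module.exists_finite_presentation A N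
    have hS := LinearMap.shortExact_shortComplexKer hf
    have hsurj := precomp_extClass_surjective_of_projective_X₂
      (ModuleCat.of A (CharacterModule M)) hS (n + 1)
    -- Dimension shift: injectivity of `x` passes to the syzygy because `Ext` of `P` vanishes in
    -- positive degrees.
    have := ih (LinearMap.shortComplexKer f).X₁ fun e he ↦ by
      have h1 := h (hS.extClass.comp e (add_comm 1 (n + 1))) (by
        rw [← Ext.comp_smul, he, Ext.comp_zero])
      obtain ⟨e', rfl⟩ := Ext.contravariant_sequence_exact₁ hS _ _ _ h1
      rw [Ext.eq_zero_of_projective e', Ext.comp_zero]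
    refine subsingleton_of_forall_eq 0 fun e ↦ ?_
    obtain ⟨e', rfl⟩ := hsurj e
    rw [Subsingleton.elim e' 0, map_zero]

end Ext

/-! ### Testing on the residue field, and dimension shifting -/

section Ext

open CategoryTheory Abelian
open scoped Pointwise

/-- The vanishing of the higher `Ext` groups into the character module of a finite module over a
noetherian local algebra `B` may be tested on the residue field of `A`. -/
lemma subsingleton_ext_characterModule_of_residueField {A : Type u} [CommRing A]
    [Small.{w} A] [IsNoetherianRing A] [IsLocalRing A] (B : Type v) [CommRing B] [Algebra A B]
    [IsLocalRing B] [IsNoetherianRing B] [IsLocalHom (algebraMap A B)] {M : Type w}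
    [AddCommGroup M] [Module A M] [Module B M] [IsScalarTower A B M] [Module.Finite B M]
    {k : ModuleCat.{w} A}
    (ek : k ≃ₗ[A] A ⧸ IsLocalRing.maximalIdeal A) {p : ℕ}
    (hk : ∀ i, p < i → Subsingleton (Ext k (ModuleCat.of A (CharacterModule M)) i)) (I : Ideal A) :
    ∀ (N : Type w) [AddCommGroup N] [Module A N] [Module.Finite A N],
      I ≤ Module.annihilator A N → ∀ i, p < i →
        Subsingleton (Ext (ModuleCat.of A N) (ModuleCat.of A (CharacterModule M)) i) := by
  -- Noetherian induction on an ideal killing `N`; a prime filtration reduces each stage to `A/q`.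
  induction I using WellFoundedGT.induction with
  | ind I ih =>
  intro N _ _ hN
  induction hN using IsNoetherianRing.induction_on_isQuotientEquivQuotientPrime A with
  | subsingleton N =>
    intro _ i _
    have h0 : 𝟙 (ModuleCat.of A N) = 0 := by
      ext y
      exact Subsingleton.elim (α := N) _ _
    refine subsingleton_of_forall_eq 0 fun e ↦ ?_
    rw [← Ext.mk₀_id_comp e, h0, Ext.mk₀_zero, Ext.zero_comp]
  | exact N₁ N₂ N₃ f g hf hg hfg h₁ h₃ =>
    intro hI i hi
    have h₁ := h₁ (hI.trans (LinearMap.annihilator_le_of_injective f hf)) i hi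
    have h₃ := h₃ (hI.trans (LinearMap.annihilator_le_of_surjective g hg)) i hi
    let S := ModuleCat.shortComplexOfCompEqZero f g hfg.linearMap_comp_eq_zero
    have hS : S.ShortExact := ModuleCat.shortComplex_shortExact S hfg hf hg
    refine subsingleton_of_forall_eq 0 fun e ↦ ?_
    obtain ⟨e', rfl⟩ := Ext.contravariant_sequence_exact₂ hS _ e (h₁.elim _ _)
    rw [h₃.elim e' 0, Ext.comp_zero]
  | quotient N q e =>
    intro hI i hi
    have hann : Module.annihilator A N = q.1 := by
      rw [e.annihilator_eq, Ideal.annihilator_quotient]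
    rw [hann] at hI
    rcases hI.lt_or_eq with hlt | rfl
    · exact ih _ hlt N hann.ge i hi
    rcases (IsLocalRing.le_maximalIdeal q.2.ne_top).eq_or_lt with heq | hlt
    · have e' : N ≃ₗ[A] k := e ≪≫ₗ Submodule.quotEquivOfEq _ _ heq ≪≫ₗ ek.symm
      have := hk i hi
      have hid : 𝟙 (ModuleCat.of A N) = ModuleCat.ofHom e'.toLinearMap ≫
          ModuleCat.ofHom e'.symm.toLinearMap := by
        ext y
        exact (e'.symm_apply_apply y).symm
      refine subsingleton_of_forall_eq 0 fun a ↦ ?_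
      rw [← Ext.mk₀_id_comp a, hid, ← Ext.mk₀_comp_mk₀,
        Ext.comp_assoc_of_second_deg_zero,
        Subsingleton.elim ((Ext.mk₀ (ModuleCat.ofHom e'.symm.toLinearMap)).comp a _) 0,
        Ext.comp_zero]
    -- For `x ∈ 𝔪` outside `q`, the induction hypothesis handles `A/(q + (x))`. So `x` acts
    -- injectively on `Ext^i(A/q, M⋆)`, and Nakayama kills that group.
    · obtain ⟨x, hxm, hxq⟩ := SetLike.exists_of_lt hlt
      obtain ⟨n, rfl⟩ : ∃ n, i = n + 1 := ⟨i - 1, by omega⟩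
      refine subsingleton_ext_characterModule_of_forall_smul (B := B) (x := x)
        (map_nonunit (algebraMap A B) x hxm) n _ fun a ha ↦ ?_
      have hreg : IsSMulRegular N x := by
        refine IsSMulRegular.of_injective e.toLinearMap e.injective ?_
        refine isSMulRegular_iff_right_eq_zero_of_smul.mpr fun y hy ↦ ?_
        obtain ⟨y, rfl⟩ := Ideal.Quotient.mk_surjective y
        rw [Algebra.smul_def, Ideal.Quotient.algebraMap_eq, ← map_mul,
          Ideal.Quotient.eq_zero_iff_mem] at hy
        exact Ideal.Quotient.eq_zero_iff_mem.mpr ((q.2.mem_or_mem hy).resolve_left hxq)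
      have hS := IsSMulRegular.smulShortComplex_shortExact (M := ModuleCat.of A N) hreg
      have hlt' : q.1 < q.1 ⊔ Ideal.span {x} := by
        refine lt_of_le_of_ne le_sup_left fun h ↦ hxq ?_
        rw [h]
        exact Ideal.mem_sup_right (Ideal.mem_span_singleton_self x)
      have hquot : Subsingleton (Ext (ModuleCat.of A (QuotSMulTop x N))
          (ModuleCat.of A (CharacterModule M)) (n + 1)) := by
        refine ih _ hlt' _ (sup_le ?_ ?_) _ hi
        · exact hann.ge.trans
            (LinearMap.annihilator_le_of_surjective _ (Submodule.mkQ_surjective _))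
        · rw [Ideal.span_singleton_le_iff_mem]
          exact QuotSMulTop.mem_annihilator N x
      have ha' : (Ext.mk₀ ((ModuleCat.of A N).smulShortComplex x).f).comp a (zero_add _) = 0 := by
        have : x • a = (Ext.mk₀ (x • 𝟙 (ModuleCat.of A N))).comp a (zero_add _) := by
          rw [Ext.mk₀_smul, Ext.smul_comp, Ext.mk₀_id_comp]
        exact this.symm.trans ha
      obtain ⟨a', rfl⟩ := Ext.contravariant_sequence_exact₂ hS _ a ha'
      have h0 : a' = 0 := hquot.elim _ _
      rw [h0, Ext.comp_zero]
      rfl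

/-- Dimension shifting: vanishing of `Ext` into the character module of a syzygy. -/
lemma subsingleton_ext_characterModule_ker {A : Type u} [CommRing A] [Small.{w} A]
    {F M : Type w} [AddCommGroup F] [Module A F] [AddCommGroup M] [Module A M] [Module.Flat A F]
    {g : F →ₗ[A] M} (hg : Function.Surjective g) (N : ModuleCat.{w} A) (n : ℕ)
    (h : Subsingleton (Ext N (ModuleCat.of A (CharacterModule M)) (n + 2))) :
    Subsingleton (Ext N (ModuleCat.of A (CharacterModule (LinearMap.ker g))) (n + 1)) := by
  have hex := CharacterModule.dual_exact g.exact_subtype_ker_map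
  let S := ModuleCat.shortComplexOfCompEqZero _ _ hex.linearMap_comp_eq_zero
  have hS : S.ShortExact := ModuleCat.shortComplex_shortExact S hex
    (CharacterModule.dual_injective_of_surjective _ hg)
    (CharacterModule.dual_surjective_of_injective _ (LinearMap.ker g).injective_subtype)
  -- The dual of a flat module is injective.
  have : Injective S.X₂ := by
    rw [← Module.injective_iff_injective_object, ← Module.Flat.iff_characterModule_injective]
    infer_instance
  refine subsingleton_of_forall_eq 0 fun e ↦ ?_
  obtain ⟨e', rfl⟩ := Ext.covariant_sequence_exact₃ N hS e rfl (h.elim _ _)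
  rw [Ext.eq_zero_of_injective e', Ext.zero_comp]

/-- A module is flat if the first `Ext` groups of finite modules into its character module
vanish. -/
lemma Module.Flat.of_subsingleton_ext_characterModule {A : Type u} [CommRing A] {M : Type max u v}
    [AddCommGroup M] [Module A M]
    (h : ∀ (N : Type max u v) [AddCommGroup N] [Module A N] [Module.Finite A N],
      Subsingleton (Ext (ModuleCat.of A N) (ModuleCat.of A (CharacterModule M)) 1)) :
    Module.Flat A M := by
  rw [Module.Flat.iff_characterModule_baer]
  intro I g
  -- Baer's criterion needs only `Ext¹(A/I, M⋆) = 0`; `ULift` moves `A/I` into the universe of `M`.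
  let f : ULift.{v} A →ₗ[A] ULift.{v} (A ⧸ I) :=
    ULift.moduleEquiv.symm.toLinearMap ∘ₗ I.mkQ ∘ₗ ULift.moduleEquiv.toLinearMap
  have hf : Function.Surjective f :=
    ULift.moduleEquiv.symm.surjective.comp (I.mkQ_surjective.comp ULift.moduleEquiv.surjective)
  have hS := LinearMap.shortExact_shortComplexKer hf
  have hmem : ∀ y : LinearMap.ker f, y.1.down ∈ I := fun y ↦
    (Submodule.Quotient.mk_eq_zero _).mp (congrArg ULift.down y.2)
  let φ : LinearMap.ker f →ₗ[A] CharacterModule M :=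
    g ∘ₗ LinearMap.codRestrict I (ULift.moduleEquiv.toLinearMap ∘ₗ (LinearMap.ker f).subtype) hmem
  obtain ⟨e, he⟩ := Ext.contravariant_sequence_exact₁ hS _ (Ext.mk₀ (ModuleCat.ofHom φ)) rfl
    ((h (ULift.{v} (A ⧸ I))).elim _ _)
  obtain ⟨ψ, rfl⟩ := (Ext.mk₀_bijective _ _).2 e
  rw [Ext.mk₀_comp_mk₀] at he
  have he' := congrArg ModuleCat.Hom.hom ((Ext.mk₀_bijective _ _).1 he)
  refine ⟨ψ.hom ∘ₗ ULift.moduleEquiv.symm.toLinearMap, fun x hx ↦ ?_⟩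
  exact DFunLike.congr_fun he' (⟨⟨x⟩, congrArg ULift.up ((Submodule.Quotient.mk_eq_zero I).mpr hx)⟩ :
    LinearMap.ker f)

end Ext

/-! ### From vanishing of Ext to bounded flat resolutions -/

namespace FlatResolution

open CategoryTheory Abelian

section

variable {A : Type u} [CommRing A] {M : Type max u v} [AddCommGroup M] [Module A M]

/-- The flat resolution of length zero of a flat module. -/
def ofFlat [Module.Flat A M] : FlatResolution.{u, max u v} A M where
  X
    | 0 => M
    | _ + 1 => PUnit.{max u v + 1}
  addCommGroup
    | 0 => inferInstance
    | _ + 1 => (inferInstance : AddCommGroup PUnit.{max u v + 1})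
  module
    | 0 => inferInstance
    | _ + 1 => (inferInstance : Module A PUnit.{max u v + 1})
  flat
    | 0 => inferInstanceAs (Module.Flat A M)
    | _ + 1 => inferInstanceAs (Module.Flat A PUnit.{max u v + 1})
  d _ := 0
  aug := (LinearMap.id : M →ₗ[A] M)
  aug_surjective := Function.surjective_id
  exact_aug _ := ⟨fun h ↦ ⟨0, h.symm⟩, fun ⟨_, h⟩ ↦ h.symm⟩
  exact_d _ _ := ⟨fun _ ↦ ⟨0, rfl⟩, fun _ ↦ rfl⟩

variable {F : Type max u v} [AddCommGroup F] [Module A F] [Module.Flat A F] {g : F →ₗ[A] M}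
  (hg : Function.Surjective g) (G : FlatResolution.{u, max u v} A (LinearMap.ker g))

/-- A flat resolution of the kernel of a surjection from a flat module `F` to `M` extends to a flat
resolution of `M`. -/
def cons : FlatResolution.{u, max u v} A M where
  X
    | 0 => F
    | i + 1 => G.X i
  addCommGroup
    | 0 => inferInstance
    | i + 1 => G.addCommGroup i
  module
    | 0 => inferInstance
    | i + 1 => G.module i
  flat
    | 0 => inferInstanceAs (Module.Flat A F)
    | i + 1 => G.flat i
  d
    | 0 => (LinearMap.ker g).subtype ∘ₗ G.aug
    | i + 1 => G.d i
  aug := g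
  aug_surjective := hg
  exact_aug x := by
    constructor
    · intro h
      obtain ⟨y, hy⟩ := G.aug_surjective ⟨x, h⟩
      exact ⟨y, congrArg Subtype.val hy⟩
    · rintro ⟨y, rfl⟩
      exact (G.aug y).2
  exact_d
    | 0 => fun x ↦ Subtype.ext_iff.symm.trans (G.exact_aug x)
    | i + 1 => G.exact_d i

lemma subsingleton_cons_X {n : ℕ} (h : ∀ i, n < i → Subsingleton (G.X i)) :
    ∀ i, n + 1 < i → Subsingleton ((G.cons hg).X i)
  | 0, hi => absurd hi (by omega)
  | i + 1, hi => h i (by omega)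

end

/-- A module whose character module has no `Ext` group in degree `p + 1` from finite modules has a
flat resolution of length `p`. -/
lemma exists_of_subsingleton_ext {A : Type u} [CommRing A] (p : ℕ) :
    ∀ (M : Type max u v) [AddCommGroup M] [Module A M],
      (∀ (N : Type max u v) [AddCommGroup N] [Module A N] [Module.Finite A N],
        Subsingleton (Ext (ModuleCat.of A N) (ModuleCat.of A (CharacterModule M)) (p + 1))) →
      ∃ F : FlatResolution.{u, max u v} A M, ∀ i, p < i → Subsingleton (F.X i) := by
  induction p with
  | zero =>
    intro M _ _ h
    have := Module.Flat.of_subsingleton_ext_characterModule h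
    refine ⟨ofFlat, fun i hi ↦ ?_⟩
    obtain ⟨j, rfl⟩ : ∃ j, i = j + 1 := ⟨i - 1, by omega⟩
    exact inferInstanceAs (Subsingleton PUnit.{max u v + 1})
  | succ p ih =>
    intro M _ _ h
    let S := (ModuleCat.of A M).projectiveShortComplex
    have hg : Function.Surjective S.g.hom :=
      (ModuleCat.of A M).shortExact_projectiveShortComplex.moduleCat_surjective_g
    obtain ⟨G, hG⟩ := ih (LinearMap.ker S.g.hom) fun N _ _ _ ↦
      subsingleton_ext_characterModule_ker hg _ p (h N)
    exact ⟨G.cons hg, G.subsingleton_cons_X hg hG⟩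

end FlatResolution

/-! ### Associated primes, regular sequences and depth -/

section RegularSequences

open IsLocalRing RingTheory.Sequence CategoryTheory Abelian
open scoped Pointwise

/-- Prime avoidance along a ring homomorphism: either an ideal of `A` kills a nonzero element of
the finite `B`-module `M`, or it contains an element that is `M`-regular. -/
lemma exists_smul_eq_zero_or_exists_isSMulRegular {A : Type u} {B : Type v} [CommRing A]
    [CommRing B] [Algebra A B] [IsNoetherianRing B] (I : Ideal A) (M : Type w) [AddCommGroup M]
    [Module B M] [Module.Finite B M] :
    (∃ y : M, y ≠ 0 ∧ ∀ a ∈ I, algebraMap A B a • y = 0) ∨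
      ∃ x ∈ I, IsSMulRegular M (algebraMap A B x) := by
  rw [or_iff_not_imp_right]
  intro h
  push Not at h
  -- Avoidance of the contracted associated primes, whose union is the set of zero divisors. All are
  -- prime, so the exceptional slots get the dummy `⊥`.
  obtain ⟨q, hq, hle⟩ := (Ideal.subset_union_prime_finite (associatedPrimes.finite B M)
    (f := fun q ↦ q.comap (algebraMap A B)) ⊥ ⊥ (fun q hq _ _ ↦ by
      have := hq.isPrime
      exact Ideal.IsPrime.comap _) (I := I)).mp (fun x hx ↦ by
        have h1 : algebraMap A B x ∈ ⋃ q ∈ associatedPrimes B M, (q : Set B) := by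
          rw [biUnion_associatedPrimes_eq_compl_regular B M]
          exact h x hx
        simpa using h1)
  obtain ⟨y, hy⟩ := (isAssociatedPrime_iff.mp (AssociatedPrimes.mem_iff.mp hq)).2
  refine ⟨y, ?_, fun a ha ↦ ?_⟩
  · rintro rfl
    exact hq.isPrime.ne_top (by rw [hy]; simp)
  · have : algebraMap A B a ∈ q := hle ha
    rw [hy] at this
    simpa using this

variable {B : Type v} [CommRing B] [IsNoetherianRing B]

/-- A nonzero module has an associated prime containing any given ideal that kills a nonzero
element. -/
lemma exists_mem_associatedPrimes_of_forall_smul_eq_zero {M : Type w} [AddCommGroup M] [Module B M]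
    (I : Ideal B) {y : M} (hy : y ≠ 0) (h : ∀ b ∈ I, b • y = 0) :
    ∃ q ∈ associatedPrimes B M, I ≤ q := by
  have : Nontrivial (Submodule.span B {y}) :=
    (Submodule.nontrivial_iff_ne_bot).mpr (by simpa using hy)
  obtain ⟨q, hq⟩ := associatedPrimes.nonempty B (Submodule.span B {y})
  refine ⟨q, associatedPrimes.subset_of_injective (Submodule.injective_subtype _) hq, ?_⟩
  intro b hb
  obtain ⟨⟨z, hz⟩, hz'⟩ := (isAssociatedPrime_iff.mp (AssociatedPrimes.mem_iff.mp hq)).2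
  obtain ⟨a, rfl⟩ := Submodule.mem_span_singleton.mp hz
  rw [hz']
  simp [Submodule.mem_colon_singleton, Subtype.ext_iff, smul_comm b a, h b hb]

variable [IsLocalRing B]

/-- The length of a regular sequence on a finite module is at most the dimension of the quotient by
any associated prime. -/
lemma RingTheory.Sequence.IsWeaklyRegular.length_le_ringKrullDim_quotient {rs : List B} :
    ∀ {M : Type w} [AddCommGroup M] [Module B M] [Module.Finite B M],
      (∀ r ∈ rs, r ∈ maximalIdeal B) → IsWeaklyRegular M rs → ∀ {q : Ideal B},
        q ∈ associatedPrimes B M → (rs.length : WithBot ℕ∞) ≤ ringKrullDim (B ⧸ q) := by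
  induction rs with
  | nil =>
    intro M _ _ _ _ _ q hq
    have := hq.isPrime
    exact ringKrullDim_nonneg_of_nontrivial
  | cons x rs ih =>
    intro M _ _ _ hm hreg q hq
    have hqp := hq.isPrime
    obtain ⟨hx, hreg⟩ := (isWeaklyRegular_cons_iff _ _ _).mp hreg
    have hxm := hm x List.mem_cons_self
    obtain ⟨y, hy⟩ := (isAssociatedPrime_iff.mp (AssociatedPrimes.mem_iff.mp hq)).2
    have hy0 : y ≠ 0 := by
      rintro rfl
      exact hqp.ne_top (by rw [hy]; simp)
    have hqy : ∀ b, b ∈ q ↔ b • y = 0 := fun b ↦ by rw [hy]; simp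
    have hxq : x ∉ q := fun h ↦ hy0 (hx (by simpa using (hqy x).mp h : x • y = x • 0))
    let N : Submodule B M := Submodule.torsionBySet B M q
    have hN : ∀ m, m ∈ N ↔ ∀ b ∈ q, b • m = 0 := fun m ↦ by
      simp [N, Submodule.mem_torsionBySet_iff]
    -- If `N ≤ xM`, regularity of `x` gives `N = xN`, hence `N = 0`, yet `y ∈ N`. The class of `z`
    -- yields an associated prime of `M/xM` containing `q + (x)`, strictly above `q`.
    obtain ⟨z, hzN, hz⟩ : ∃ z ∈ N, z ∉ x • (⊤ : Submodule B M) := by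
      by_contra! hc
      have hbot : N = ⊥ := by
        refine Submodule.eq_bot_of_le_smul_of_le_jacobson_bot (Ideal.span {x}) N
          (IsNoetherian.noetherian _) (fun m hmN ↦ ?_)
          (((Ideal.span_singleton_le_iff_mem _).mpr hxm).trans (maximalIdeal_le_jacobson _))
        obtain ⟨m', -, rfl⟩ := (Submodule.mem_smul_pointwise_iff_exists _ _ _).mp (hc m hmN)
        refine Submodule.smul_mem_smul (Ideal.mem_span_singleton_self x) ((hN _).mpr fun b hb ↦ ?_)
        refine hx ?_
        change x • b • m' = x • (0 : M)
        rw [smul_comm, (hN _).mp hmN b hb, smul_zero]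
      have : y ∈ N := (hN y).mpr fun b hb ↦ (hqy b).mp hb
      rw [hbot] at this
      exact hy0 this
    obtain ⟨q', hq', hle⟩ := exists_mem_associatedPrimes_of_forall_smul_eq_zero
      (M := QuotSMulTop x M) (q ⊔ Ideal.span {x}) (y := Submodule.Quotient.mk z)
      (by rwa [Ne, Submodule.Quotient.mk_eq_zero]) (by
        intro b hb
        obtain ⟨b₁, hb₁, b₂, hb₂, rfl⟩ := Submodule.mem_sup.mp hb
        obtain ⟨a, rfl⟩ := Ideal.mem_span_singleton'.mp hb₂
        rw [add_smul, ← Submodule.Quotient.mk_smul, (hN z).mp hzN b₁ hb₁, mul_comm, mul_smul,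
          Submodule.Quotient.mk_zero, zero_add]
        exact Module.mem_annihilator.mp (QuotSMulTop.mem_annihilator M x) _)
    have hlen := ih (fun r hr ↦ hm r (List.mem_cons_of_mem _ hr)) hreg hq'
    have hxnz : Ideal.Quotient.mk q x ∈ nonZeroDivisors (B ⧸ q) :=
      mem_nonZeroDivisors_of_ne_zero (by rwa [Ne, Ideal.Quotient.eq_zero_iff_mem])
    have h1 := ringKrullDim_quotient_succ_le_of_nonZeroDivisor hxnz
    have h2 : ringKrullDim (B ⧸ q') ≤
        ringKrullDim ((B ⧸ q) ⧸ Ideal.span {Ideal.Quotient.mk q x}) := by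
      refine ringKrullDim_le_of_surjective (Ideal.Quotient.lift _
        (Ideal.Quotient.factor (le_sup_left.trans hle)) ?_) ?_
      · intro b hb
        obtain ⟨a, rfl⟩ := Ideal.mem_span_singleton'.mp hb
        have : Ideal.Quotient.mk q' x = 0 := Ideal.Quotient.eq_zero_iff_mem.mpr
          (hle (Ideal.mem_sup_right (Ideal.mem_span_singleton_self x)))
        rw [map_mul, Ideal.Quotient.factor_mk, this, mul_zero]
      · exact Ideal.Quotient.lift_surjective_of_surjective _ _
          (Ideal.Quotient.factor_surjective _)
    calc (((x :: rs).length : ℕ) : WithBot ℕ∞) = rs.length + 1 := by simp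
      _ ≤ ringKrullDim (B ⧸ q') + 1 := by gcongr
      _ ≤ _ := le_trans (by gcongr) h1

/-- Modulo a regular element, the maximal length of a regular sequence drops by at most one. -/
lemma RingTheory.Sequence.IsRegular.exists_isRegular_quotSMulTop [Small.{w} B] {M : Type w}
    [AddCommGroup M] [Module B M] [Module.Finite B M] [Nontrivial M] {ys : List B}
    (hm : ∀ y ∈ ys, y ∈ maximalIdeal B) (hys : IsRegular M ys) {x : B} (hxm : x ∈ maximalIdeal B)
    (hx : IsSMulRegular M x) :
    ∃ zs : List B, ys.length ≤ zs.length + 1 ∧ (∀ z ∈ zs, z ∈ maximalIdeal B) ∧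
      IsRegular (QuotSMulTop x M) zs := by
  have : Nontrivial (QuotSMulTop x M) := nontrivial_quotSMulTop_of_mem_maximalIdeal M hxm
  have hlt : ∀ (M : Type w) [AddCommGroup M] [Module B M] [Module.Finite B M] [Nontrivial M],
      maximalIdeal B • (⊤ : Submodule B M) < ⊤ := fun M _ _ _ _ ↦
    lt_top_iff_ne_top.mpr (Submodule.top_ne_ideal_smul_of_le_jacobson_annihilator
      (maximalIdeal_le_jacobson _)).symm
  let k : ModuleCat.{w} B := ModuleCat.of B (Shrink.{w} (B ⧸ maximalIdeal B))
  have : Module.Finite B k := Module.Finite.equiv (Shrink.linearEquiv B (B ⧸ maximalIdeal B)).symm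
  have hsupp : Module.support B k = PrimeSpectrum.zeroLocus (maximalIdeal B) := by
    rw [(Shrink.linearEquiv B (B ⧸ maximalIdeal B)).support_eq, Module.support_eq_zeroLocus,
      Ideal.annihilator_quotient]
  have hext := ModuleCat.subsingleton_ext_of_exists_isRegular (maximalIdeal B) k hsupp.le
    (ModuleCat.of B M) (hlt M) ys hm hys
  -- Regular sequences are detected by vanishing of `Ext^i(k, -)` in low degrees; the long exact
  -- sequence for `x` costs one degree.
  obtain ⟨zs, hlen, hzm, hzs⟩ := ModuleCat.exists_isRegular_of_exists_subsingleton_ext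
    (maximalIdeal B) (ys.length - 1) (ModuleCat.of B (QuotSMulTop x M)) (hlt _) k hsupp (by
      intro i hi
      have h1 := hext i (by omega)
      have h2 := hext (i + 1) (by omega)
      refine subsingleton_of_forall_eq 0 fun e ↦ ?_
      obtain ⟨e', rfl⟩ := Ext.covariant_sequence_exact₃ k
        (IsSMulRegular.smulShortComplex_shortExact (M := ModuleCat.of B M) hx) e rfl (h2.elim _ _)
      have h0 : e' = 0 := h1.elim _ _
      rw [h0, Ext.zero_comp]
      rfl)
  exact ⟨zs, by omega, hzm, hzs⟩

end RegularSequences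

/-! ### The common sequence and the dimension formula -/

section Main

open IsLocalRing RingTheory.Sequence CategoryTheory Abelian
open scoped Pointwise

/-- Every nonzero finite module over a noetherian local algebra over a regular local ring admits a
regular sequence from the maximal ideal of the base that computes its flat dimension and bounds
its depth. -/
lemma exists_isRegular_map_algebraMap {A : Type u} {B : Type v} [CommRing A] [CommRing B]
    [IsLocalRing A] [IsLocalRing B] [IsNoetherianRing B] [Algebra A B]
    [IsLocalHom (algebraMap A B)] {rs : List A} (hrs : IsWeaklyRegular A rs)
    (hrs' : Ideal.ofList rs = maximalIdeal A) {k : ModuleCat.{max u v} A}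
    (hk : maximalIdeal A ≤ Module.annihilator A k) [HasProjectiveDimensionLT k (rs.length + 1)]
    {c : ℕ} (hc : ringKrullDim (B ⧸ (maximalIdeal A).map (algebraMap A B)) = c) (n : ℕ) :
    ∀ (M : Type max u v) [AddCommGroup M] [Module A M] [Module B M] [IsScalarTower A B M]
      [Module.Finite B M] [Nontrivial M], Module.supportDim B M < n →
      ∃ xs : List A, (∀ x ∈ xs, x ∈ maximalIdeal A) ∧ IsRegular M (xs.map (algebraMap A B)) ∧
        (∀ i, rs.length < i + xs.length →
          Subsingleton (Ext k (ModuleCat.of A (CharacterModule M)) i)) ∧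
        (∀ (F : FlatResolution.{u, max u v} A M) (l : ℕ), (∀ i, l < i → Subsingleton (F.X i)) →
          rs.length ≤ l + xs.length) ∧
        ∀ ys : List B, (∀ y ∈ ys, y ∈ maximalIdeal B) → IsRegular M ys →
          ys.length ≤ xs.length + c := by
  induction n with
  | zero =>
    intro M _ _ _ _ _ _ h
    obtain ⟨m, hm⟩ := WithBot.ne_bot_iff_exists.mp (Module.supportDim_ne_bot_of_nontrivial B M)
    rw [← hm] at h
    exact absurd (by exact_mod_cast h : m < 0) not_lt_zero
  | succ n ih =>
    intro M _ _ _ _ _ _ hdim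
    -- Either `𝔪` kills a nonzero element and the sequence stops, or it can be prolonged and the
    -- support dimension drops.
    rcases exists_smul_eq_zero_or_exists_isSMulRegular (B := B) (maximalIdeal A) M with
      ⟨y, hy0, hy⟩ | ⟨x, hxm, hx⟩
    · refine ⟨[], by simp, by simpa using IsRegular.nil _ _, fun i hi ↦ ?_, fun F l hl ↦ ?_,
        fun ys hys hreg ↦ ?_⟩
      · exact HasProjectiveDimensionLT.subsingleton k (rs.length + 1) i (by simpa using hi) _
      · refine (F.hasWeaklyRegularResolution hrs l M hl).length_le hy0 fun r hr ↦ ?_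
        rw [← algebraMap_smul B]
        exact hy r (hrs' ▸ Ideal.subset_span hr)
      · obtain ⟨q, hq, hle⟩ := exists_mem_associatedPrimes_of_forall_smul_eq_zero
          ((maximalIdeal A).map (algebraMap A B)) hy0 (fun b hb ↦ by
            have : (maximalIdeal A).map (algebraMap A B) ≤ LinearMap.ker
                (LinearMap.toSpanSingleton B M y) := Ideal.map_le_iff_le_comap.mpr fun a ha ↦ hy a ha
            exact this hb)
        have h1 := IsWeaklyRegular.length_le_ringKrullDim_quotient hys hreg.1 hq
        have h2 := ringKrullDim_le_of_surjective (Ideal.Quotient.factor hle)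
          (Ideal.Quotient.factor_surjective hle)
        rw [hc] at h2
        simpa using (by exact_mod_cast h1.trans h2 : ys.length ≤ c)
    · have hxB : algebraMap A B x ∈ maximalIdeal B := map_nonunit (algebraMap A B) x hxm
      have hntr := nontrivial_quotSMulTop_of_mem_maximalIdeal M hxB
      obtain ⟨xs, hxs, hreg, hU, hL, hC⟩ := ih (QuotSMulTop (algebraMap A B x) M) (by
        have h1 := Module.supportDim_quotSMulTop_succ_eq_supportDim hx hxB
        rw [← h1] at hdim
        push_cast at hdim
        by_contra! hge
        exact absurd hdim (not_lt.mpr (by gcongr)))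
      have hxA : IsSMulRegular M x := fun a b (hab : x • a = x • b) ↦
        hx (show algebraMap A B x • a = algebraMap A B x • b by
          rw [algebraMap_smul, algebraMap_smul, hab])
      let π : M →ₗ[A] QuotSMulTop (algebraMap A B x) M :=
        (algebraMap A B x • (⊤ : Submodule B M)).mkQ.restrictScalars A
      have hπ : Function.Surjective π :=
        Submodule.mkQ_surjective (algebraMap A B x • (⊤ : Submodule B M))
      have hex : Function.Exact (LinearMap.lsmul A M x) π := by
        intro m
        refine (LinearMap.exact_lsmul_mkQ_smul_top M (algebraMap A B x) m).trans ?_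
        simp
      refine ⟨x :: xs, ?_, ?_, fun i hi ↦ ?_, fun F l hl ↦ ?_, fun ys hys hyreg ↦ ?_⟩
      · simpa using ⟨hxm, hxs⟩
      · rw [List.map_cons, isRegular_cons_iff]
        exact ⟨hx, hreg⟩
      · exact subsingleton_ext_characterModule_of_exact_lsmul k (hk hxm) hxA hπ hex i
          (hU (i + 1) (by simp at hi; omega))
      · have := hL (F.cone hxA hπ hex) (l + 1) (F.subsingleton_cone_X hxA hπ hex hl)
        simp only [List.length_cons]
        omega
      · obtain ⟨zs, hlen, hzs, hzreg⟩ := IsRegular.exists_isRegular_quotSMulTop hys hyreg hxB hx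
        have := hC zs hzs hzreg
        simp only [List.length_cons]
        omega

theorem mainTheorem10 {A : Type u} {B : Type v} [CommRing A] [CommRing B]
    [IsRegularLocalRing A] [IsCohenMacaulayLocalRing B]
    [Algebra A B] [IsLocalHom (algebraMap A B)] :
    ∃ p a b c : ℕ,
      flatDimension A B = (p : WithBot ℕ∞) ∧
      ringKrullDim A = (a : WithBot ℕ∞) ∧
      ringKrullDim B = (b : WithBot ℕ∞) ∧
      ringKrullDim (B ⧸ (IsLocalRing.maximalIdeal A).map (algebraMap A B)) = (c : WithBot ℕ∞) ∧
      (p : ℤ) = (a : ℤ) - (b : ℤ) + (c : ℤ) := by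
  have hmB : (maximalIdeal A).map (algebraMap A B) ≤ maximalIdeal B :=
    Ideal.map_le_iff_le_comap.mpr fun a ha ↦ map_nonunit (algebraMap A B) a ha
  have hnt : Nontrivial (B ⧸ (maximalIdeal A).map (algebraMap A B)) :=
    Ideal.Quotient.nontrivial_iff.mpr fun h ↦ Ideal.IsPrime.ne_top' (top_le_iff.mp (h ▸ hmB))
  have := IsLocalRing.of_surjective' _
    (Ideal.Quotient.mk_surjective (I := (maximalIdeal A).map (algebraMap A B)))
  have hnat : ∀ (R : Type _) [CommRing R] [IsLocalRing R] [IsNoetherianRing R],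
      ∃ n : ℕ, ringKrullDim R = n := fun R _ _ _ ↦ by
    have h := maximalIdeal_height_eq_ringKrullDim (R := R)
    obtain ⟨n, hn⟩ := ENat.ne_top_iff_exists.mp (Ideal.height_ne_top (I := maximalIdeal R) Ideal.IsPrime.ne_top')
    exact ⟨n, by rw [← h, ← hn]; rfl⟩
  obtain ⟨a, ha⟩ : ∃ n : ℕ, ringKrullDim A = n :=
    ⟨_, IsRegularLocalRing.spanFinrank_maximalIdeal.symm⟩
  obtain ⟨b, hb⟩ := hnat B
  obtain ⟨c, hc⟩ := hnat (B ⧸ (maximalIdeal A).map (algebraMap A B))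
  obtain ⟨rs, hlen, hrs, hrs'⟩ := IsRegularLocalRing.exists_isRegular_ofList_eq a A ha
  let k : ModuleCat.{max u v} A := ModuleCat.of A (Shrink.{max u v} (A ⧸ Ideal.ofList rs))
  let ek : k ≃ₗ[A] A ⧸ maximalIdeal A :=
    Shrink.linearEquiv A _ ≪≫ₗ Submodule.quotEquivOfEq _ _ hrs'
  have hproj : HasProjectiveDimensionLT k (rs.length + 1) :=
    (projectiveDimension_le_iff k rs.length).mp
      (ModuleCat.projectiveDimension_quotient_eq_length rs hrs).le
  obtain ⟨xs, hxs, hreg, hU, hL, hC⟩ := exists_isRegular_map_algebraMap (B := B) hrs.1 hrs'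
    (k := k) (by rw [ek.annihilator_eq, Ideal.annihilator_quotient]) hc (b + 1) (ULift.{u} B) (by
      refine lt_of_le_of_lt (Module.supportDim_le_ringKrullDim B _) ?_
      rw [hb]
      exact_mod_cast b.lt_succ_self)
  have e : ULift.{u} B ≃ₗ[B] B := ULift.moduleEquiv
  -- the Cohen-Macaulay property gives `b ≤ g + c`
  have h1 : b ≤ xs.length + c := by
    have : localDepth B ≤ (xs.length + c : ℕ) := iSup₂_le fun ys ⟨hys, hyreg⟩ ↦ by
      exact_mod_cast hC ys hys ((e.isRegular_congr ys).mpr hyreg)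
    have h2 := IsCohenMacaulayLocalRing.depth_eq_dim (R := B)
    rw [hb] at h2
    have h2 : localDepth B = b := by exact_mod_cast h2
    rw [h2] at this
    exact_mod_cast this
  -- The sequence lies in `𝔪`, so its quotient maps onto `B/𝔪B`.
  have h2 : c + xs.length ≤ b := by
    have h3 := ringKrullDim_add_length_eq_ringKrullDim_of_isRegular _
      ((e.isRegular_congr _).mp hreg)
    have hle : Ideal.ofList (xs.map (algebraMap A B)) ≤
        (maximalIdeal A).map (algebraMap A B) := by
      rw [← Ideal.map_ofList]
      exact Ideal.map_mono (Ideal.span_le.mpr hxs)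
    have h4 := ringKrullDim_le_of_surjective (Ideal.Quotient.factor hle)
      (Ideal.Quotient.factor_surjective hle)
    rw [hc] at h4
    rw [hb, List.length_map] at h3
    have : ((c + xs.length : ℕ) : WithBot ℕ∞) ≤ b := by
      rw [← h3]
      push_cast
      gcongr
    exact_mod_cast this
  -- Together with the previous two bounds this yields `g ≤ a`, so the subtraction `a - g` in `ℕ` is
  -- not truncated.
  have h3 : b ≤ c + a := by
    have h4 := ringKrullDim_le_ringKrullDim_quotient_add_spanFinrank
      ((maximalIdeal A).map (algebraMap A B)) (by rwa [IsLocalRing.ringJacobson_eq_maximalIdeal])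
    have h5 : ((maximalIdeal A).map (algebraMap A B)).spanFinrank ≤ (maximalIdeal A).spanFinrank :=
      Ideal.spanFinrank_map_le_of_fg _ (IsNoetherian.noetherian _)
    have h6 := IsRegularLocalRing.spanFinrank_maximalIdeal (R := A)
    rw [ha] at h6
    have h6 : (maximalIdeal A).spanFinrank = a := by exact_mod_cast h6
    rw [hb, hc] at h4
    have : b ≤ c + ((maximalIdeal A).map (algebraMap A B)).spanFinrank := by exact_mod_cast h4
    omega
  refine ⟨a - xs.length, a, b, c, ?_, ha, hb, hc, by omega⟩
  obtain ⟨F, hF⟩ := FlatResolution.exists_of_subsingleton_ext (a - xs.length) (ULift.{u} B)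
    fun N _ _ _ ↦ subsingleton_ext_characterModule_of_residueField B ek
      (fun i hi ↦ hU i (by omega)) ⊥ N bot_le _ (Nat.lt_succ_self _)
  apply le_antisymm
  · exact sInf_le ⟨F.ofULift, fun i hi ↦ hF i (by exact_mod_cast hi)⟩
  · refine le_sInf ?_
    rintro n ⟨G, hG⟩
    induction n with
    -- Length `⊥` would make even the term in degree zero vanish, forcing `B = 0`.
    | bot =>
      have := hG 0 (WithBot.bot_lt_coe _)
      have : Subsingleton B := G.aug_surjective.subsingleton
      exact absurd this (not_subsingleton B)
    | coe n =>
      induction n with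
      | top => exact le_top
      | coe n =>
        have := hL G.toULift n fun i hi ↦ hG i (by exact_mod_cast hi)
        have : a - xs.length ≤ n := by omega
        exact WithBot.coe_le_coe.mpr (Nat.cast_le (α := ℕ∞) |>.mpr this)

end Main
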